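/- Let $(\Omega,\Sigma,\mu)$ be a finite measure space. A Banach function space $X(\mu)$ is an ideal of $L^0(\mu)$ (for the $\mu$-a.e. order) containing $\chi_\Omega$, equipped with a complete norm such that $\|f\|_{X}\le\|g\|_{X}$ whenever $f,g\in X(\mu)$ and $|f|\le|g|$. It has the Fatou property if, for every increasing norm-bounded sequence $(f_n)_n$ in $X(\mu)$ that converges $\mu$-a.e. to a measurable function $f$, we have $f\in X(\mu)$. Let $\mathrm{Lip}_0(\mathbb R)$ be the space of Lipschitz functions $\varphi:\mathbb R\to\mathbb R$ with $\varphi(0)=0$, normed by the Lipschitz constant $\mathrm{Lip}(\varphi)$. Let $\mathcal M(X,Y)$ be the space of multiplication operators $M_g:X(\mu)\to Y(\mu)$, $f\mapsto gf$, identified with the functions $g$, with the operator norm. The Köthe–Bochner space $\mathcal M(X,Y)(\mu,\mathrm{Lip}_0(\mathbb R))$ consists of the strongly measurable functions $\Phi:\Omega\to\mathrm{Lip}_0(\mathbb R)$ (a.e. limits of simple functions in the norm of $\mathrm{Lip}_0(\mathbb R)$) with $\mathrm{Lip}(\Phi(\cdot))\in\mathcal M(X,Y)$, and $\|\Phi\|_{\mathcal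 M(X,Y)(\mu,\mathrm{Lip}_0(\mathbb R))}=\|\mathrm{Lip}(\Phi(\cdot))\|_{\mathcal M(X,Y)}$. For $\Phi:\Omega\to\mathrm{Lip}_0(\mathbb R)$ and $T:X(\mu)\to Y(\mu)$, write $T=T_\Phi$ if, for all $f\in X(\mu)$, $T(f)(w)=\Phi(w)(f(w))$ for $\mu$-a.e. $w$. The map $T$ is strongly lattice Lipschitz if $T=T_\Phi$ for some $\Phi\in\mathcal M(X,Y)(\mu,\mathrm{Lip}_0(\mathbb R))$. **Theorem.** Let $X(\mu)$ and $Y(\mu)$ be Banach function spaces such that $X(\mu)\subseteq Y(\mu)$ and $Y(\mu)$ has the Fatou property. For a map $T:X(\mu)\to Y(\mu)$ the following are equivalent. (i) $T$ is strongly lattice Lipschitz. (ii) There are a strongly measurable function $\Phi:\Omega\to\mathrm{Lip}_0(\mathbb R)$ with $T=T_\Phi$ and a sequence $(\Phi_n)_n$ of essentially bounded functions in $L^\infty(\mu,\mathrm{Lip}_0(\mathbb R))$ that converges $\mu$-a.e. to $\Phi$ (in the norm of $\mathrm{Lip}_0(\mathbb R)$) and satisfies $\sup_n\|\mathrm{Lip}(\Phi_n(\cdot))\|_{\mathcal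 M(X,Y)}<\infty$. Moreover, if these conditions hold, then every strongly measurable $\Phi$ with $T=T_\Phi$ belongs to $\mathcal M(X,Y)(\mu,\mathrm{Lip}_0(\mathbb R))$, and the sequence $(\Phi_n)_n$ in (ii) can be chosen so that $$\sup_n\|\Phi_n\|_{\mathcal M(X,Y)(\mu,\mathrm{Lip}_0(\mathbb R))}=\|\Phi\|_{\mathcal M(X,Y)(\mu,\mathrm{Lip}_0(\mathbb R))}.$$ -/

import Mathlib

open MeasureTheory Filter Topology Set
open scoped ENNReal

noncomputable section

/-- The vector space of Lipschitz functions `φ : ℝ → ℝ` with `φ 0 = 0`. -/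
def lipZeroSubmodule : Submodule ℝ (ℝ → ℝ) where
  carrier := {φ | φ 0 = 0 ∧ ∃ K : ℝ, ∀ x y, |φ x - φ y| ≤ K * |x - y|}
  zero_mem' := ⟨rfl, 0, fun x y => by simp⟩
  add_mem' := by
    rintro φ ψ ⟨hφ, K, hK⟩ ⟨hψ, L, hL⟩
    refine ⟨by simp [hφ, hψ], K + L, fun x y => ?_⟩
    calc |(φ + ψ) x - (φ + ψ) y| = |(φ x - φ y) + (ψ x - ψ y)| := by
          simp only [Pi.add_apply]; congr 1; ring
      _ ≤ |φ x - φ y| + |ψ x - ψ y| := abs_add_le _ _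
      _ ≤ (K + L) * |x - y| := by linarith [hK x y, hL x y]
  smul_mem' := by
    rintro c φ ⟨hφ, K, hK⟩
    refine ⟨by simp [hφ], |c| * K, fun x y => ?_⟩
    calc |(c • φ) x - (c • φ) y| = |c| * |φ x - φ y| := by
          rw [← abs_mul]; simp only [Pi.smul_apply, smul_eq_mul]; congr 1; ring
      _ ≤ |c| * (K * |x - y|) := mul_le_mul_of_nonneg_left (hK x y) (abs_nonneg c)
      _ = |c| * K * |x - y| := by ring

/-- The space `Lip₀(ℝ)`. It is a type of its own, so that its topology is the one of the
Lipschitz norm below and not the topology of pointwise convergence. -/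
def LipZero : Type := lipZeroSubmodule

namespace LipZero

instance : AddCommGroup LipZero := inferInstanceAs (AddCommGroup lipZeroSubmodule)

instance : Module ℝ LipZero := inferInstanceAs (Module ℝ lipZeroSubmodule)

instance : CoeFun LipZero (fun _ => ℝ → ℝ) := ⟨fun φ => φ.1⟩

@[ext] theorem ext {φ ψ : LipZero} (h : ∀ x, φ x = ψ x) : φ = ψ := Subtype.ext (funext h)

@[simp] theorem zero_apply (x : ℝ) : (0 : LipZero) x = 0 := rfl

@[simp] theorem add_apply (φ ψ : LipZero) (x : ℝ) : (φ + ψ) x = φ x + ψ x := rfl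

@[simp] theorem smul_apply (c : ℝ) (φ : LipZero) (x : ℝ) : (c • φ) x = c * φ x := rfl

@[simp] theorem map_zero (φ : LipZero) : φ 0 = 0 := φ.2.1

/-- The Lipschitz constant `Lip(φ)`: the least `K ≥ 0` with `|φ x - φ y| ≤ K |x - y|` for all
`x, y`. -/
def lip (φ : LipZero) : ℝ := sInf {K : ℝ | 0 ≤ K ∧ ∀ x y, |φ x - φ y| ≤ K * |x - y|}

theorem lip_nonneg (φ : LipZero) : 0 ≤ φ.lip := Real.sInf_nonneg fun _ h => h.1

theorem lip_le {φ : LipZero} {K : ℝ} (hK : 0 ≤ K) (h : ∀ x y, |φ x - φ y| ≤ K * |x - y|) :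
    φ.lip ≤ K := csInf_le ⟨0, fun _ h => h.1⟩ ⟨hK, h⟩

theorem abs_sub_le (φ : LipZero) (x y : ℝ) : |φ x - φ y| ≤ φ.lip * |x - y| := by
  rcases eq_or_ne x y with rfl | hxy
  · simp
  have hpos : 0 < |x - y| := abs_pos.2 (sub_ne_zero.2 hxy)
  rw [← div_le_iff₀ hpos]
  obtain ⟨K, hK⟩ := φ.2.2
  refine le_csInf ⟨max K 0, le_max_right _ _, fun a b => (hK a b).trans ?_⟩ ?_
  · exact mul_le_mul_of_nonneg_right (le_max_left _ _) (abs_nonneg _)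
  · rintro L ⟨-, hL⟩
    rw [div_le_iff₀ hpos]
    exact hL x y

instance : Norm LipZero := ⟨lip⟩

theorem norm_eq_lip (φ : LipZero) : ‖φ‖ = φ.lip := rfl

theorem lip_smul_le (c : ℝ) (φ : LipZero) : (c • φ).lip ≤ |c| * φ.lip := by
  refine lip_le (mul_nonneg (abs_nonneg c) φ.lip_nonneg) fun x y => ?_
  rw [smul_apply, smul_apply, ← mul_sub, abs_mul, mul_assoc]
  exact mul_le_mul_of_nonneg_left (φ.abs_sub_le x y) (abs_nonneg c)

theorem normedSpaceCore : NormedSpace.Core ℝ LipZero where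
  norm_nonneg := lip_nonneg
  norm_smul c φ := by
    refine le_antisymm (lip_smul_le c φ) ?_
    rcases eq_or_ne c 0 with rfl | hc
    · rw [norm_zero, zero_mul]
      exact lip_nonneg _
    · have h := lip_smul_le c⁻¹ (c • φ)
      rw [inv_smul_smul₀ hc, abs_inv] at h
      exact (le_inv_mul_iff₀ (abs_pos.2 hc)).1 h
  norm_triangle φ ψ := by
    refine lip_le (add_nonneg φ.lip_nonneg ψ.lip_nonneg) fun x y => ?_
    have h := abs_add_le (φ x - φ y) (ψ x - ψ y)
    have e : (φ + ψ) x - (φ + ψ) y = (φ x - φ y) + (ψ x - ψ y) := by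
      simp only [add_apply]; ring
    rw [e, norm_eq_lip, norm_eq_lip]
    linarith [φ.abs_sub_le x y, ψ.abs_sub_le x y]
  norm_eq_zero_iff φ := by
    constructor
    · intro h
      ext x
      have h1 := φ.abs_sub_le x 0
      have h2 : φ.lip = 0 := h
      rw [h2, zero_mul, map_zero, sub_zero] at h1
      exact abs_nonpos_iff.1 h1
    · rintro rfl
      exact le_antisymm (lip_le le_rfl fun x y => by simp) (lip_nonneg _)

instance : NormedAddCommGroup LipZero := NormedAddCommGroup.ofCore normedSpaceCore

instance : NormedSpace ℝ LipZero := NormedSpace.ofCore normedSpaceCore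

end LipZero

/-- A Banach function space over `μ`: an ideal of `L⁰(μ)` (for the `μ`-a.e. order) that contains
the constant function `1`, with a complete lattice norm. -/
structure BanachFunctionSpace {Ω : Type*} [MeasurableSpace Ω] (μ : Measure Ω) where
  /-- The underlying vector subspace of `L⁰(μ)`. -/
  toSubmodule : Submodule ℝ (Ω →ₘ[μ] ℝ)
  /-- The norm. -/
  normFun : toSubmodule → ℝ
  normFun_nonneg : ∀ f, 0 ≤ normFun f
  normFun_smul : ∀ (c : ℝ) f, normFun (c • f) = |c| * normFun f
  normFun_add_le : ∀ f g, normFun (f + g) ≤ normFun f + normFun g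
  normFun_eq_zero_iff : ∀ f, normFun f = 0 ↔ f = 0
  /-- Every Cauchy sequence converges. -/
  complete : ∀ u : ℕ → toSubmodule,
    (∀ ε > 0, ∃ N, ∀ m ≥ N, ∀ n ≥ N, normFun (u m - u n) < ε) →
      ∃ f, Tendsto (fun n => normFun (u n - f)) atTop (𝓝 0)
  /-- The ideal property. -/
  ideal : ∀ f g : Ω →ₘ[μ] ℝ, |f| ≤ |g| → g ∈ toSubmodule → f ∈ toSubmodule
  /-- The norm is a lattice norm. -/
  normFun_mono : ∀ f g : toSubmodule,
    |(f : Ω →ₘ[μ] ℝ)| ≤ |(g : Ω →ₘ[μ] ℝ)| → normFun f ≤ normFun g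
  one_mem : (1 : Ω →ₘ[μ] ℝ) ∈ toSubmodule

namespace BanachFunctionSpace

variable {Ω : Type*} [MeasurableSpace Ω] {μ : Measure Ω}

/-- The elements of `X(μ)`, as a type that carries the norm of `X(μ)`. -/
def Elem (X : BanachFunctionSpace μ) : Type _ := X.toSubmodule

instance : CoeSort (BanachFunctionSpace μ) (Type _) := ⟨Elem⟩

instance (X : BanachFunctionSpace μ) : AddCommGroup X :=
  inferInstanceAs (AddCommGroup X.toSubmodule)

instance (X : BanachFunctionSpace μ) : Module ℝ X :=
  inferInstanceAs (Module ℝ X.toSubmodule)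

/-- The `μ`-a.e. class of functions that an element of `X(μ)` is. -/
def Elem.toAEEqFun {X : BanachFunctionSpace μ} (f : X) : Ω →ₘ[μ] ℝ := f.1

instance (X : BanachFunctionSpace μ) : CoeOut X (Ω →ₘ[μ] ℝ) := ⟨Elem.toAEEqFun⟩

instance (X : BanachFunctionSpace μ) : Norm X := ⟨X.normFun⟩

theorem normedSpaceCore (X : BanachFunctionSpace μ) : NormedSpace.Core ℝ X where
  norm_nonneg := X.normFun_nonneg
  norm_smul := X.normFun_smul
  norm_triangle := X.normFun_add_le
  norm_eq_zero_iff := X.normFun_eq_zero_iff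

instance (X : BanachFunctionSpace μ) : NormedAddCommGroup X :=
  NormedAddCommGroup.ofCore X.normedSpaceCore

instance (X : BanachFunctionSpace μ) : NormedSpace ℝ X :=
  NormedSpace.ofCore X.normedSpaceCore

/-- The Fatou property: the `μ`-a.e. limit of an increasing norm bounded sequence of elements of
`X(μ)` belongs to `X(μ)`. -/
def HasFatouProperty (X : BanachFunctionSpace μ) : Prop :=
  ∀ (f : ℕ → X) (g : Ω →ₘ[μ] ℝ),
    Monotone (fun n => (f n : Ω →ₘ[μ] ℝ)) →
    (∃ C : ℝ, ∀ n, ‖f n‖ ≤ C) →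
    (∀ᵐ w ∂μ, Tendsto (fun n => (f n : Ω →ₘ[μ] ℝ) w) atTop (𝓝 (g w))) →
    g ∈ X.toSubmodule

/-- The space `𝓜(X,Y)` of multiplication operators, each identified with its symbol: the
functions `g ∈ L⁰(μ)` for which `f ↦ g f` is a continuous linear operator `M_g : X(μ) → Y(μ)`. -/
def multipliers (X Y : BanachFunctionSpace μ) : Submodule ℝ (Ω →ₘ[μ] ℝ) where
  carrier := {g | ∃ M : X →L[ℝ] Y, ∀ f : X, (M f : Ω →ₘ[μ] ℝ) = g * (f : Ω →ₘ[μ] ℝ)}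
  zero_mem' := ⟨0, fun f => by
    change (0 : Ω →ₘ[μ] ℝ) = 0 * f.toAEEqFun
    induction f.toAEEqFun using AEEqFun.induction_on with
    | _ f hf =>
      rw [AEEqFun.zero_def, AEEqFun.mk_mul_mk]
      simp only [AEEqFun.mk_eq_mk]
      exact .of_forall fun w => (zero_mul (f w)).symm⟩
  add_mem' := by
    rintro g h ⟨M, hM⟩ ⟨N, hN⟩
    refine ⟨M + N, fun f => ?_⟩
    change (M f).toAEEqFun + (N f).toAEEqFun = _
    rw [hM f, hN f]
    apply AEEqFun.ext
    filter_upwards [AEEqFun.coeFn_add (g * f.toAEEqFun) (h * f.toAEEqFun),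
      AEEqFun.coeFn_mul g f.toAEEqFun, AEEqFun.coeFn_mul h f.toAEEqFun,
      AEEqFun.coeFn_mul (g + h) f.toAEEqFun, AEEqFun.coeFn_add g h] with w h1 h2 h3 h4 h5
    simp only [h1, h2, h3, h4, h5, Pi.add_apply, Pi.mul_apply, add_mul]
  smul_mem' := by
    rintro c g ⟨M, hM⟩
    refine ⟨c • M, fun f => ?_⟩
    change c • (M f).toAEEqFun = _
    rw [hM f]
    apply AEEqFun.ext
    filter_upwards [AEEqFun.coeFn_smul c (g * f.toAEEqFun), AEEqFun.coeFn_mul g f.toAEEqFun,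
      AEEqFun.coeFn_mul (c • g) f.toAEEqFun, AEEqFun.coeFn_smul c g] with w h1 h2 h3 h4
    simp only [h1, h2, h3, h4, Pi.smul_apply, Pi.mul_apply, smul_eq_mul, mul_assoc]

/-- The multiplication operator `M_g : X(μ) → Y(μ)`, `f ↦ g f`. -/
def mulOperator {X Y : BanachFunctionSpace μ} (g : multipliers X Y) : X →L[ℝ] Y :=
  g.2.choose

theorem mulOperator_apply {X Y : BanachFunctionSpace μ} (g : multipliers X Y) (f : X) :
    (mulOperator g f : Ω →ₘ[μ] ℝ) = (g : Ω →ₘ[μ] ℝ) * (f : Ω →ₘ[μ] ℝ) :=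
  g.2.choose_spec f

/-- The norm of `𝓜(X,Y)`: the operator norm of `M_g`. -/
def multiplierNorm {X Y : BanachFunctionSpace μ} (g : multipliers X Y) : ℝ :=
  ‖mulOperator g‖

/-- `Φ` belongs to the Köthe–Bochner space `𝓜(X,Y)(μ, E)`: it is strongly measurable and
`w ↦ ‖Φ(w)‖` belongs to `𝓜(X,Y)`. (`AEStronglyMeasurable` means a.e. limit of simple
functions.) -/
def MemKotheBochner (X Y : BanachFunctionSpace μ) {E : Type*} [NormedAddCommGroup E]
    (Φ : Ω → E) : Prop :=
  ∃ hΦ : AEStronglyMeasurable Φ μ, AEEqFun.mk (fun w => ‖Φ w‖) hΦ.norm ∈ multipliers X Y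

/-- The norm of `𝓜(X,Y)(μ, E)`: the norm of `w ↦ ‖Φ(w)‖` in `𝓜(X,Y)`. -/
def kotheBochnerNorm {X Y : BanachFunctionSpace μ} {E : Type*} [NormedAddCommGroup E]
    {Φ : Ω → E} (hΦ : MemKotheBochner X Y Φ) : ℝ :=
  multiplierNorm (⟨AEEqFun.mk (fun w => ‖Φ w‖) hΦ.1.norm, hΦ.2⟩ : multipliers X Y)

/-- `T = T_Φ`, where `T_Φ` is the superposition operator `T_Φ(f)(w) = Φ(w)(f(w))`. -/
def IsSuperposition {X Y : BanachFunctionSpace μ} (T : X → Y) (Φ : Ω → LipZero) : Prop :=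
  ∀ f : X, ∀ᵐ w ∂μ, (T f : Ω →ₘ[μ] ℝ) w = Φ w ((f : Ω →ₘ[μ] ℝ) w)

/-- `T` is strongly lattice Lipschitz: `T = T_Φ` for some `Φ ∈ 𝓜(X,Y)(μ, Lip₀(ℝ))`. -/
def StronglyLatticeLipschitz {X Y : BanachFunctionSpace μ} (T : X → Y) : Prop :=
  ∃ Φ : Ω → LipZero, MemKotheBochner X Y Φ ∧ IsSuperposition T Φ

end BanachFunctionSpace

end

/-! The function `Φ` in `T = T_Φ` is unique up to null sets: testing on the rational constants
determines `Φ(w)` on `ℚ`, hence everywhere by continuity. The multipliers of `X(μ)` into `Y(μ)`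
are exactly the functions `g` with `g X(μ) ⊆ Y(μ)`, because a solid seminorm on a Banach lattice
is automatically bounded: otherwise a sum of small positive vectors on which it is arbitrarily
large would dominate all of them.

Truncating `Φ` to the sets `{‖Φ‖ ≤ n}` gives essentially bounded functions that converge to `Φ`
and whose norms are at most `‖Φ‖`; a multiple of one of them has norm exactly `‖Φ‖`. Conversely,
if `Φₙ → Φ` with bounded norms, then for every `f ∈ X(μ)` the functions `‖Φₙ‖ f` are bounded in
`Y(μ)`, and the Fatou property, applied to the tail infima of their absolute values, puts `‖Φ‖ f`
into `Y(μ)`.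
-/

theorem exists_seminorm_le_of_solid {E : Type*} [NormedAddCommGroup E] [NormedSpace ℝ E]
    [Lattice E] [IsOrderedAddMonoid E] [HasSolidNorm E] [CompleteSpace E] (p : Seminorm ℝ E)
    (hp : ∀ ⦃u v : E⦄, |u| ≤ |v| → p u ≤ p v) : ∃ C : ℝ, ∀ f, p f ≤ C * ‖f‖ := by
  by_contra! hunbdd
  have hwitness : ∀ n : ℕ, ∃ u : E, 0 ≤ u ∧ ‖u‖ ≤ (1 / 2 : ℝ) ^ n ∧ (n : ℝ) < p u := by
    intro n
    obtain ⟨f, hf⟩ := hunbdd (n * 2 ^ n)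
    have hf0 : 0 < ‖f‖ := norm_pos_iff.2 <| by
      rintro rfl
      simp at hf
    have hc : 0 < (2 ^ n * ‖f‖)⁻¹ := by positivity
    refine ⟨|(2 ^ n * ‖f‖)⁻¹ • f|, abs_nonneg _, le_of_eq ?_, ?_⟩
    · rw [norm_abs_eq_norm, norm_smul, Real.norm_of_nonneg hc.le]
      field_simp
      simp
    · calc (n : ℝ) < (2 ^ n * ‖f‖)⁻¹ * p f := by
            rw [lt_inv_mul_iff₀ (by positivity)]
            linarith
        _ = p ((2 ^ n * ‖f‖)⁻¹ • f) := by rw [map_smul_eq_mul, Real.norm_of_nonneg hc.le]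
        _ ≤ p |(2 ^ n * ‖f‖)⁻¹ • f| := hp (abs_abs _).ge
  choose u hu_nonneg hu_norm hu_large using hwitness
  have hu_summable : Summable u := .of_norm_bounded summable_geometric_two hu_norm
  obtain ⟨n, hn⟩ := exists_nat_gt (p (∑' k, u k))
  have hu_le : |u n| ≤ |∑' k, u k| := by
    rw [abs_of_nonneg (hu_nonneg n), abs_of_nonneg (tsum_nonneg hu_nonneg)]
    exact hu_summable.le_tsum n fun k _ => hu_nonneg k
  exact lt_irrefl _ ((hn.trans (hu_large n)).trans_le (hp hu_le))

section TailInfimum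

variable {α : Type*} [ConditionallyCompleteLinearOrder α] {a : ℕ → α}

theorem monotone_ciInf_nat_add (ha : BddBelow (range a)) : Monotone fun n => ⨅ k, a (n + k) := by
  refine monotone_nat_of_le_succ fun n => le_ciInf fun k => ?_
  rw [add_assoc]
  exact ciInf_le (ha.mono (range_comp_subset_range (n + ·) a)) (1 + k)

theorem tendsto_ciInf_nat_add [TopologicalSpace α] [OrderTopology α] [DenselyOrdered α] {l : α}
    (h : Tendsto a atTop (𝓝 l)) : Tendsto (fun n => ⨅ k, a (n + k)) atTop (𝓝 l) := by
  refine tendsto_order.2 ⟨fun b hb => ?_, fun b hb => ?_⟩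
  · obtain ⟨c, hbc, hcl⟩ := exists_between hb
    obtain ⟨N, hN⟩ := eventually_atTop.1 (h.eventually_const_lt hcl)
    filter_upwards [eventually_ge_atTop N] with n hn
    exact hbc.trans_le (le_ciInf fun k => (hN (n + k) (by omega)).le)
  · filter_upwards [h.eventually_lt_const hb] with n hn
    exact (ciInf_le (h.bddBelow_range.mono (range_comp_subset_range (n + ·) a)) 0).trans_lt hn

end TailInfimum

theorem exists_memLp_top_tendsto {Ω E : Type*} [MeasurableSpace Ω] {μ : Measure Ω}
    [NormedAddCommGroup E] {Φ : Ω → E} (hΦ : AEStronglyMeasurable Φ μ) :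
    ∃ Φs : ℕ → Ω → E, (∀ n, MemLp (Φs n) ∞ μ) ∧ (∀ n w, ‖Φs n w‖ ≤ ‖Φ w‖) ∧
      ∀ w, Tendsto (fun n => Φs n w) atTop (𝓝 (Φ w)) := by
  let S : ℕ → Set Ω := fun n => {w | ‖hΦ.mk Φ w‖ ≤ n}
  have hS : ∀ n, MeasurableSet (S n) := fun n =>
    hΦ.stronglyMeasurable_mk.norm.measurable measurableSet_Iic
  refine ⟨fun n => (S n).indicator Φ, fun n => ?_, fun n w => norm_indicator_le_norm_self _ _,
    fun w => ?_⟩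
  · refine memLp_top_of_bound (hΦ.indicator (hS n)) n ?_
    filter_upwards [hΦ.ae_eq_mk] with w hw
    by_cases h : w ∈ S n
    · rw [indicator_of_mem h, hw]
      exact h
    · rw [indicator_of_notMem h, norm_zero]
      exact n.cast_nonneg
  · obtain ⟨N, hN⟩ := exists_nat_ge ‖hΦ.mk Φ w‖
    refine tendsto_const_nhds.congr' ?_
    filter_upwards [eventually_ge_atTop N] with n hn
    exact (indicator_of_mem (s := S n) (hN.trans (Nat.cast_le.2 hn)) Φ).symm

namespace LipZero

theorem continuous (φ : LipZero) : Continuous φ :=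
  (LipschitzWith.of_dist_le' (K := φ.lip) φ.abs_sub_le).continuous

theorem eq_of_eq_rat {φ ψ : LipZero} (h : ∀ q : ℚ, φ q = ψ q) : φ = ψ := by
  ext x
  exact congrFun (Rat.denseRange_cast.equalizer φ.continuous ψ.continuous (funext h)) x

end LipZero

instance {Ω β : Type*} [MeasurableSpace Ω] {μ : Measure Ω} [TopologicalSpace β]
    [AddCommGroup β] [IsTopologicalAddGroup β] [PartialOrder β] [IsOrderedAddMonoid β] :
    IsOrderedAddMonoid (Ω →ₘ[μ] β) where
  add_le_add_left f g hfg h := by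
    rw [← AEEqFun.coeFn_le] at hfg ⊢
    filter_upwards [hfg, AEEqFun.coeFn_add f h, AEEqFun.coeFn_add g h] with w hw hf hg
    rw [hf, hg]
    exact add_le_add_left hw _

namespace BanachFunctionSpace

variable {Ω : Type*} [MeasurableSpace Ω] {μ : Measure Ω}

section BanachLattice

variable {X : BanachFunctionSpace μ}

noncomputable instance : CoeFun X (fun _ => Ω → ℝ) := ⟨fun f => f.toAEEqFun⟩

theorem abs_le_abs_iff_ae {f g : Ω →ₘ[μ] ℝ} : |f| ≤ |g| ↔ ∀ᵐ w ∂μ, |f w| ≤ |g w| := by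
  rw [← AEEqFun.coeFn_le]
  refine eventually_congr ?_
  filter_upwards [AEEqFun.coeFn_abs f, AEEqFun.coeFn_abs g] with w hf hg
  rw [hf, hg]

theorem mem_of_ae_abs_le (f : X) {g : Ω →ₘ[μ] ℝ} (h : ∀ᵐ w ∂μ, |g w| ≤ |f w|) :
    g ∈ X.toSubmodule :=
  X.ideal g f (abs_le_abs_iff_ae.2 h) f.2

theorem norm_le_norm_of_ae_abs_le {f g : X} (h : ∀ᵐ w ∂μ, |f w| ≤ |g w|) : ‖f‖ ≤ ‖g‖ :=
  X.normFun_mono f g (abs_le_abs_iff_ae.2 h)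

theorem Elem.ext_ae {f g : X} (h : f =ᵐ[μ] g) : f = g :=
  Subtype.ext (AEEqFun.ext h)

theorem Elem.coeFn_smul (c : ℝ) (f : X) : ⇑(c • f) =ᵐ[μ] fun w => c * f w :=
  AEEqFun.coeFn_smul c f.toAEEqFun

theorem sup_mem (f g : X) : f.toAEEqFun ⊔ g.toAEEqFun ∈ X.toSubmodule := by
  have habs (h : X) : |h.toAEEqFun| ∈ X.toSubmodule := X.ideal _ _ (abs_abs _).le h.2
  refine X.ideal _ (|f.toAEEqFun| + |g.toAEEqFun|) ?_ (X.toSubmodule.add_mem (habs f) (habs g))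
  rw [abs_of_nonneg (add_nonneg (abs_nonneg f.toAEEqFun) (abs_nonneg g.toAEEqFun)), abs_le']
  have hf : |f.toAEEqFun| ≤ |f.toAEEqFun| + |g.toAEEqFun| :=
    le_add_of_nonneg_right (abs_nonneg _)
  have hg : |g.toAEEqFun| ≤ |f.toAEEqFun| + |g.toAEEqFun| :=
    le_add_of_nonneg_left (abs_nonneg _)
  exact ⟨sup_le ((le_abs_self _).trans hf) ((le_abs_self _).trans hg),
    (neg_le_neg le_sup_left).trans ((neg_le_abs _).trans hf)⟩

theorem inf_mem (f g : X) : f.toAEEqFun ⊓ g.toAEEqFun ∈ X.toSubmodule := by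
  rw [eq_sub_of_add_eq (inf_add_sup f.toAEEqFun g.toAEEqFun)]
  exact X.toSubmodule.sub_mem (X.toSubmodule.add_mem f.2 g.2) (sup_mem f g)

noncomputable instance : Lattice X :=
  Subtype.lattice (P := (· ∈ X.toSubmodule)) (fun f g hf hg => sup_mem ⟨f, hf⟩ ⟨g, hg⟩)
    fun f g hf hg => inf_mem ⟨f, hf⟩ ⟨g, hg⟩

theorem Elem.abs_le_abs_iff_ae {f g : X} : |f| ≤ |g| ↔ ∀ᵐ w ∂μ, |f w| ≤ |g w| :=
  BanachFunctionSpace.abs_le_abs_iff_ae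

instance : IsOrderedAddMonoid X where
  add_le_add_left _ _ hfg h := add_le_add_left (α := Ω →ₘ[μ] ℝ) hfg h.toAEEqFun

instance : HasSolidNorm X where
  solid f g := X.normFun_mono f g

instance : CompleteSpace X := by
  refine Metric.complete_of_cauchySeq_tendsto fun u hu => ?_
  obtain ⟨f, hf⟩ := X.complete u fun ε hε => by
    obtain ⟨N, hN⟩ := Metric.cauchySeq_iff.1 hu ε hε
    exact ⟨N, fun m hm n hn => (dist_eq_norm (u m) (u n)).symm.trans_lt (hN m hm n hn)⟩
  exact ⟨f, tendsto_iff_norm_sub_tendsto_zero.2 hf⟩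

end BanachLattice

section Fatou

theorem HasFatouProperty.mem_of_tendsto {Y : BanachFunctionSpace μ} (hY : Y.HasFatouProperty)
    {u : ℕ → Y} {C : ℝ} (hC : ∀ n, ‖u n‖ ≤ C) {f : Ω →ₘ[μ] ℝ}
    (hlim : ∀ᵐ w ∂μ, Tendsto (fun n => u n w) atTop (𝓝 (f w))) : f ∈ Y.toSubmodule := by
  -- The Fatou property applies to the tail infima `⨅ k, |uₙ₊ₖ|`, which increase to `|f|`.
  have hbdd (w : Ω) : BddBelow (range fun n => |u n w|) :=
    ⟨0, forall_mem_range.2 fun n => abs_nonneg _⟩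
  have hmeas (n : ℕ) : AEStronglyMeasurable (fun w => ⨅ k, |u (n + k) w|) μ :=
    (AEMeasurable.iInf fun k =>
      (u (n + k)).toAEEqFun.aestronglyMeasurable.norm.aemeasurable).aestronglyMeasurable
  have hdom (n : ℕ) : ∀ᵐ w ∂μ, |AEEqFun.mk _ (hmeas n) w| ≤ |u n w| := by
    filter_upwards [AEEqFun.coeFn_mk _ (hmeas n)] with w hw
    rw [hw, abs_of_nonneg (Real.iInf_nonneg fun k => abs_nonneg _)]
    exact ciInf_le ((hbdd w).mono (range_comp_subset_range (n + ·) _)) 0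
  let v (n : ℕ) : Y := ⟨AEEqFun.mk _ (hmeas n), mem_of_ae_abs_le (u n) (hdom n)⟩
  have hv : ∀ᵐ w ∂μ, ∀ n, v n w = ⨅ k, |u (n + k) w| :=
    ae_all_iff.2 fun n => AEEqFun.coeFn_mk _ (hmeas n)
  have hv_mono : Monotone fun n => (v n).toAEEqFun := fun m n hmn => by
    rw [← AEEqFun.coeFn_le]
    filter_upwards [hv] with w hw
    rw [hw, hw]
    exact monotone_ciInf_nat_add (hbdd w) hmn
  have habs : |f| ∈ Y.toSubmodule := by
    have hv_norm (n : ℕ) : ‖v n‖ ≤ C := (norm_le_norm_of_ae_abs_le (hdom n)).trans (hC n)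
    refine hY v |f| hv_mono ⟨C, hv_norm⟩ ?_
    filter_upwards [hlim, hv, AEEqFun.coeFn_abs f] with w hw hvw hf
    rw [hf]
    exact (tendsto_ciInf_nat_add hw.abs).congr fun n => (hvw n).symm
  exact Y.ideal f |f| (abs_abs f).ge habs

end Fatou

section Multipliers

variable {X Y : BanachFunctionSpace μ}

/-- The multiplication operator `f ↦ g f` as a linear map, for a function `g` that multiplies
`X(μ)` into `Y(μ)`; continuity is not required. -/
noncomputable def mulLinearMap (g : Ω →ₘ[μ] ℝ)
    (hg : ∀ f : X, g * f.toAEEqFun ∈ Y.toSubmodule) : X →ₗ[ℝ] Y where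
  toFun f := ⟨g * f.toAEEqFun, hg f⟩
  map_add' f h := Elem.ext_ae <| by
    change ⇑(g * (f.toAEEqFun + h.toAEEqFun)) =ᵐ[μ] ⇑(g * f.toAEEqFun + g * h.toAEEqFun)
    filter_upwards [AEEqFun.coeFn_add (g * f.toAEEqFun) (g * h.toAEEqFun),
      AEEqFun.coeFn_mul g f.toAEEqFun, AEEqFun.coeFn_mul g h.toAEEqFun,
      AEEqFun.coeFn_mul g (f.toAEEqFun + h.toAEEqFun),
      AEEqFun.coeFn_add f.toAEEqFun h.toAEEqFun] with w h1 h2 h3 h4 h5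
    simp only [h1, h2, h3, h4, h5, Pi.add_apply, Pi.mul_apply, mul_add]
  map_smul' c f := Elem.ext_ae <| by
    change ⇑(g * (c • f.toAEEqFun)) =ᵐ[μ] ⇑(c • (g * f.toAEEqFun))
    filter_upwards [AEEqFun.coeFn_smul c (g * f.toAEEqFun), AEEqFun.coeFn_mul g f.toAEEqFun,
      AEEqFun.coeFn_mul g (c • f.toAEEqFun), AEEqFun.coeFn_smul c f.toAEEqFun] with w h1 h2 h3 h4
    simp only [h1, h2, h3, h4, Pi.smul_apply, Pi.mul_apply, smul_eq_mul, mul_left_comm]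

theorem coeFn_mulLinearMap (g : Ω →ₘ[μ] ℝ) (hg : ∀ f : X, g * f.toAEEqFun ∈ Y.toSubmodule)
    (f : X) : mulLinearMap g hg f =ᵐ[μ] fun w => g w * f w :=
  AEEqFun.coeFn_mul g f.toAEEqFun

theorem exists_norm_mulLinearMap_le (g : Ω →ₘ[μ] ℝ)
    (hg : ∀ f : X, g * f.toAEEqFun ∈ Y.toSubmodule) :
    ∃ C : ℝ, ∀ f : X, ‖mulLinearMap g hg f‖ ≤ C * ‖f‖ := by
  refine exists_seminorm_le_of_solid ((normSeminorm ℝ Y).comp (mulLinearMap g hg))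
    fun u v huv => norm_le_norm_of_ae_abs_le ?_
  filter_upwards [Elem.abs_le_abs_iff_ae.1 huv, coeFn_mulLinearMap g hg u,
    coeFn_mulLinearMap g hg v] with w hw hu hv
  rw [hu, hv, abs_mul, abs_mul]
  gcongr

theorem mem_multipliers_iff {g : Ω →ₘ[μ] ℝ} :
    g ∈ multipliers X Y ↔ ∀ f : X, g * f.toAEEqFun ∈ Y.toSubmodule :=
  ⟨fun ⟨M, hM⟩ f => hM f ▸ (M f).2, fun hg =>
    ⟨(mulLinearMap g hg).mkContinuousOfExistsBound (exists_norm_mulLinearMap_le g hg),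
      fun _ => rfl⟩⟩

theorem coeFn_mulOperator (g : multipliers X Y) (f : X) :
    mulOperator g f =ᵐ[μ] fun w => g.1 w * f w := by
  rw [show (mulOperator g f).toAEEqFun = _ from mulOperator_apply g f]
  exact AEEqFun.coeFn_mul _ _

theorem mem_multipliers_of_ae_abs_le {g : Ω →ₘ[μ] ℝ} (h : multipliers X Y)
    (hgh : ∀ᵐ w ∂μ, |g w| ≤ |h.1 w|) : g ∈ multipliers X Y := by
  refine mem_multipliers_iff.2 fun f => mem_of_ae_abs_le (mulOperator h f) ?_
  filter_upwards [hgh, AEEqFun.coeFn_mul g f.toAEEqFun, coeFn_mulOperator h f] with w hw hg hh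
  rw [hg, hh, Pi.mul_apply, abs_mul, abs_mul]
  gcongr

theorem multiplierNorm_mono {g h : multipliers X Y} (hgh : ∀ᵐ w ∂μ, |g.1 w| ≤ |h.1 w|) :
    multiplierNorm g ≤ multiplierNorm h := by
  refine (mulOperator g).opNorm_le_bound (norm_nonneg _) fun f =>
    (norm_le_norm_of_ae_abs_le ?_).trans ((mulOperator h).le_opNorm f)
  filter_upwards [hgh, coeFn_mulOperator g f, coeFn_mulOperator h f] with w hw hg hh
  rw [hg, hh, abs_mul, abs_mul]
  gcongr

theorem mulOperator_smul (c : ℝ) (g : multipliers X Y) :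
    mulOperator (c • g) = c • mulOperator g := by
  ext1 f
  refine Elem.ext_ae ?_
  filter_upwards [coeFn_mulOperator (c • g) f, coeFn_mulOperator g f,
    Elem.coeFn_smul c (mulOperator g f), AEEqFun.coeFn_smul c g.1] with w hcgf hgf hsmul hcg
  change _ = (c • mulOperator g f) w
  have hcg' : (c • g).1 w = c * g.1 w := hcg
  rw [hcgf, hsmul, hgf, hcg', mul_assoc]

theorem multiplierNorm_smul (c : ℝ) (g : multipliers X Y) :
    multiplierNorm (c • g) = |c| * multiplierNorm g := by
  rw [multiplierNorm, mulOperator_smul, norm_smul, Real.norm_eq_abs, multiplierNorm]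

theorem eq_zero_of_multiplierNorm_eq_zero {g : multipliers X Y} (hg : multiplierNorm g = 0) :
    g = 0 := by
  let e : X := ⟨1, X.one_mem⟩
  have hge : (mulOperator g e).toAEEqFun = g.1 * 1 := mulOperator_apply g e
  rw [norm_eq_zero.1 hg, mul_one] at hge
  exact Subtype.ext hge.symm

theorem mem_multipliers_of_tendsto (hY : Y.HasFatouProperty) {g : ℕ → multipliers X Y} {C : ℝ}
    (hC : ∀ n, multiplierNorm (g n) ≤ C) {h : Ω →ₘ[μ] ℝ}
    (hlim : ∀ᵐ w ∂μ, Tendsto (fun n => (g n).1 w) atTop (𝓝 (h w))) : h ∈ multipliers X Y := by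
  refine mem_multipliers_iff.2 fun f => hY.mem_of_tendsto (u := fun n => mulOperator (g n) f)
    (fun n => (mulOperator (g n)).le_of_opNorm_le (hC n) f) ?_
  filter_upwards [hlim, AEEqFun.coeFn_mul h f.toAEEqFun,
    ae_all_iff.2 fun n => coeFn_mulOperator (g n) f] with w hw hhf hgf
  rw [hhf]
  exact (hw.mul_const (f w)).congr fun n => (hgf n).symm

end Multipliers

section KotheBochner

variable {X Y : BanachFunctionSpace μ} {E : Type*} [NormedAddCommGroup E] {Φ Ψ : Ω → E}

/-- The multiplier `w ↦ ‖Φ(w)‖` attached to an element `Φ` of the Köthe–Bochner space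
`𝓜(X,Y)(μ, E)`. -/
noncomputable def MemKotheBochner.normMultiplier (hΦ : MemKotheBochner X Y Φ) :
    multipliers X Y :=
  ⟨AEEqFun.mk (fun w => ‖Φ w‖) hΦ.1.norm, hΦ.2⟩

theorem MemKotheBochner.coeFn_normMultiplier (hΦ : MemKotheBochner X Y Φ) :
    hΦ.normMultiplier.1 =ᵐ[μ] fun w => ‖Φ w‖ :=
  AEEqFun.coeFn_mk _ hΦ.1.norm

theorem MemKotheBochner.of_ae_norm_le (hΨ : MemKotheBochner X Y Ψ)
    (hΦ : AEStronglyMeasurable Φ μ) (h : ∀ᵐ w ∂μ, ‖Φ w‖ ≤ ‖Ψ w‖) : MemKotheBochner X Y Φ := by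
  refine ⟨hΦ, mem_multipliers_of_ae_abs_le hΨ.normMultiplier ?_⟩
  filter_upwards [h, AEEqFun.coeFn_mk _ hΦ.norm, hΨ.coeFn_normMultiplier] with w hw hf hg
  rwa [hf, hg, abs_norm, abs_norm]

theorem kotheBochnerNorm_nonneg (hΦ : MemKotheBochner X Y Φ) : 0 ≤ kotheBochnerNorm hΦ :=
  norm_nonneg (mulOperator hΦ.normMultiplier)

theorem kotheBochnerNorm_mono {hΦ : MemKotheBochner X Y Φ} {hΨ : MemKotheBochner X Y Ψ}
    (h : ∀ᵐ w ∂μ, ‖Φ w‖ ≤ ‖Ψ w‖) : kotheBochnerNorm hΦ ≤ kotheBochnerNorm hΨ := by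
  refine multiplierNorm_mono (g := hΦ.normMultiplier) (h := hΨ.normMultiplier) ?_
  filter_upwards [h, hΦ.coeFn_normMultiplier, hΨ.coeFn_normMultiplier] with w hw hf hg
  rwa [hf, hg, abs_norm, abs_norm]

theorem ae_eq_zero_of_kotheBochnerNorm_eq_zero {hΦ : MemKotheBochner X Y Φ}
    (h : kotheBochnerNorm hΦ = 0) : Φ =ᵐ[μ] 0 := by
  have hzero : hΦ.normMultiplier = 0 := eq_zero_of_multiplierNorm_eq_zero h
  have hcoe := hΦ.coeFn_normMultiplier
  rw [hzero] at hcoe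
  filter_upwards [hcoe, AEEqFun.coeFn_zero (μ := μ) (β := ℝ)] with w hw h0
  exact norm_eq_zero.1 (hw.symm.trans h0)

theorem MemKotheBochner.mk_norm_const_smul [NormedSpace ℝ E] (c : ℝ)
    (hΦ : MemKotheBochner X Y Φ) :
    AEEqFun.mk (fun w => ‖(c • Φ) w‖) (hΦ.1.const_smul c).norm = |c| • hΦ.normMultiplier.1 := by
  refine AEEqFun.ext ?_
  filter_upwards [AEEqFun.coeFn_mk _ (hΦ.1.const_smul c).norm, hΦ.coeFn_normMultiplier,
    AEEqFun.coeFn_smul |c| hΦ.normMultiplier.1] with w hcΦ hw hsmul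
  rw [hcΦ, hsmul, Pi.smul_apply, Pi.smul_apply, hw, norm_smul, Real.norm_eq_abs, smul_eq_mul]

theorem MemKotheBochner.const_smul [NormedSpace ℝ E] (c : ℝ) (hΦ : MemKotheBochner X Y Φ) :
    MemKotheBochner X Y (c • Φ) :=
  ⟨hΦ.1.const_smul c, hΦ.mk_norm_const_smul c ▸
    (multipliers X Y).smul_mem |c| hΦ.normMultiplier.2⟩

theorem kotheBochnerNorm_const_smul [NormedSpace ℝ E] (c : ℝ) (hΦ : MemKotheBochner X Y Φ) :
    kotheBochnerNorm (hΦ.const_smul c) = |c| * kotheBochnerNorm hΦ := by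
  have hsmul : (hΦ.const_smul c).normMultiplier = |c| • hΦ.normMultiplier :=
    Subtype.ext (hΦ.mk_norm_const_smul c)
  rw [show kotheBochnerNorm (hΦ.const_smul c) = multiplierNorm (hΦ.const_smul c).normMultiplier
    from rfl, hsmul, multiplierNorm_smul, abs_abs]
  rfl

theorem MemKotheBochner.of_tendsto (hY : Y.HasFatouProperty) {Φs : ℕ → Ω → E}
    (hΦs : ∀ n, MemKotheBochner X Y (Φs n)) {C : ℝ} (hC : ∀ n, kotheBochnerNorm (hΦs n) ≤ C)
    (hΦ : AEStronglyMeasurable Φ μ) (hlim : ∀ᵐ w ∂μ, Tendsto (fun n => Φs n w) atTop (𝓝 (Φ w))) :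
    MemKotheBochner X Y Φ := by
  refine ⟨hΦ, mem_multipliers_of_tendsto hY (g := fun n => (hΦs n).normMultiplier) hC ?_⟩
  filter_upwards [hlim, AEEqFun.coeFn_mk _ hΦ.norm,
    ae_all_iff.2 fun n => (hΦs n).coeFn_normMultiplier] with w hw hΦw hΦsw
  rw [hΦw]
  exact hw.norm.congr fun n => (hΦsw n).symm

theorem MemKotheBochner.exists_memLp_top_kotheBochnerNorm_eq [NormedSpace ℝ E]
    (hΦ : MemKotheBochner X Y Φ) : ∃ (Ψ : Ω → E) (hΨ : MemKotheBochner X Y Ψ),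
      MemLp Ψ ∞ μ ∧ kotheBochnerNorm hΨ = kotheBochnerNorm hΦ := by
  by_cases hzero : Φ =ᵐ[μ] 0
  · exact ⟨Φ, hΦ, (memLp_congr_ae hzero).2 MemLp.zero', rfl⟩
  obtain ⟨Φs, hΦs, hle, hlim⟩ := exists_memLp_top_tendsto hΦ.1
  obtain ⟨n, hn⟩ : ∃ n, ¬ Φs n =ᵐ[μ] 0 := by
    by_contra! hall
    refine hzero ?_
    filter_upwards [ae_all_iff.2 hall] with w hw
    exact tendsto_nhds_unique (hlim w) (tendsto_const_nhds.congr fun n => (hw n).symm)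
  have hmem : MemKotheBochner X Y (Φs n) := hΦ.of_ae_norm_le (hΦs n).1 (.of_forall (hle n))
  have hne : kotheBochnerNorm hmem ≠ 0 := fun h => hn (ae_eq_zero_of_kotheBochnerNorm_eq_zero h)
  refine ⟨_, hmem.const_smul (kotheBochnerNorm hΦ / kotheBochnerNorm hmem),
    (hΦs n).const_smul _, ?_⟩
  rw [kotheBochnerNorm_const_smul _ hmem, abs_div, abs_of_nonneg (kotheBochnerNorm_nonneg _),
    abs_of_nonneg (kotheBochnerNorm_nonneg _), div_mul_cancel₀ _ hne]

theorem MemKotheBochner.exists_memLp_top_isLUB [NormedSpace ℝ E] (hΦ : MemKotheBochner X Y Φ) :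
    ∃ Φs : ℕ → Ω → E, (∀ n, MemLp (Φs n) ∞ μ) ∧
      (∃ h : ∀ n, MemKotheBochner X Y (Φs n),
        IsLUB (range fun n => kotheBochnerNorm (h n)) (kotheBochnerNorm hΦ)) ∧
      ∀ᵐ w ∂μ, Tendsto (fun n => Φs n w) atTop (𝓝 (Φ w)) := by
  -- The norms of the truncations of `Φ` need not have supremum `‖Φ‖`, so they are preceded by a
  -- bounded function of norm exactly `‖Φ‖`.
  obtain ⟨Ψ, hΨ, hΨ_top, hΨ_norm⟩ := hΦ.exists_memLp_top_kotheBochnerNorm_eq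
  obtain ⟨Φs, hΦs, hle, hlim⟩ := exists_memLp_top_tendsto hΦ.1
  have hmem (n : ℕ) : MemKotheBochner X Y (Φs n) :=
    hΦ.of_ae_norm_le (hΦs n).1 (.of_forall (hle n))
  let Θ : ℕ → Ω → E
    | 0 => Ψ
    | n + 1 => Φs n
  have hΘ : ∀ n, MemKotheBochner X Y (Θ n)
    | 0 => hΨ
    | n + 1 => hmem n
  have hΘ_top : ∀ n, MemLp (Θ n) ∞ μ
    | 0 => hΨ_top
    | n + 1 => hΦs n
  have hΘ_norm : ∀ n, kotheBochnerNorm (hΘ n) ≤ kotheBochnerNorm hΦ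
    | 0 => hΨ_norm.le
    | n + 1 => kotheBochnerNorm_mono (hΦ := hmem n) (.of_forall (hle n))
  exact ⟨Θ, hΘ_top, ⟨hΘ, IsGreatest.isLUB ⟨⟨0, hΨ_norm⟩, forall_mem_range.2 hΘ_norm⟩⟩,
    .of_forall fun w => (tendsto_add_atTop_iff_nat 1).1 (hlim w)⟩

end KotheBochner

section Superposition

variable {X Y : BanachFunctionSpace μ} {T : X → Y} {Φ Ψ : Ω → LipZero}

theorem IsSuperposition.ae_eq (hΦ : IsSuperposition T Φ) (hΨ : IsSuperposition T Ψ) :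
    Φ =ᵐ[μ] Ψ := by
  let e : X := ⟨1, X.one_mem⟩
  have hrat (q : ℚ) : ∀ᵐ w ∂μ, Φ w q = Ψ w q := by
    have hqe : ⇑((q : ℝ) • e) =ᵐ[μ] fun _ => (q : ℝ) := by
      filter_upwards [Elem.coeFn_smul (q : ℝ) e, AEEqFun.coeFn_one (μ := μ) (β := ℝ)]
        with w hsmul hone
      rw [hsmul, show e w = 1 from hone, mul_one]
    filter_upwards [hΦ ((q : ℝ) • e), hΨ ((q : ℝ) • e), hqe] with w hΦw hΨw hw
    rw [← hw, ← hΦw, hΨw]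
  filter_upwards [ae_all_iff.2 hrat] with w hw using LipZero.eq_of_eq_rat hw

theorem StronglyLatticeLipschitz.memKotheBochner (hT : StronglyLatticeLipschitz T)
    (hΦ : AEStronglyMeasurable Φ μ) (hTΦ : IsSuperposition T Φ) : MemKotheBochner X Y Φ := by
  obtain ⟨Ψ, hΨ, hTΨ⟩ := hT
  exact hΨ.of_ae_norm_le hΦ ((hTΦ.ae_eq hTΨ).mono fun w hw => (congrArg norm hw).le)

end Superposition

end BanachFunctionSpace

open BanachFunctionSpace in
theorem mainTheorem1_general {Ω : Type*} [MeasurableSpace Ω] (μ : Measure Ω)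
    (X Y : BanachFunctionSpace μ) (hY : Y.HasFatouProperty) (T : X → Y) :
    (StronglyLatticeLipschitz T ↔
      ∃ Φ : Ω → LipZero, AEStronglyMeasurable Φ μ ∧ IsSuperposition T Φ ∧
        ∃ Φs : ℕ → Ω → LipZero,
          (∀ n, MemLp (Φs n) ∞ μ) ∧
          (∃ (h : ∀ n, MemKotheBochner X Y (Φs n)) (C : ℝ), ∀ n, kotheBochnerNorm (h n) ≤ C) ∧
          ∀ᵐ w ∂μ, Tendsto (fun n => Φs n w) atTop (𝓝 (Φ w))) ∧
    (StronglyLatticeLipschitz T →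
      ∀ Φ : Ω → LipZero, AEStronglyMeasurable Φ μ → IsSuperposition T Φ →
        ∃ (hΦ : MemKotheBochner X Y Φ) (Φs : ℕ → Ω → LipZero),
          (∀ n, MemLp (Φs n) ∞ μ) ∧
          (∃ h : ∀ n, MemKotheBochner X Y (Φs n),
            IsLUB (range fun n => kotheBochnerNorm (h n)) (kotheBochnerNorm hΦ)) ∧
          ∀ᵐ w ∂μ, Tendsto (fun n => Φs n w) atTop (𝓝 (Φ w))) := by
  refine ⟨⟨?_, ?_⟩, fun hT Φ hΦ hTΦ => ?_⟩
  · rintro ⟨Φ, hΦ, hTΦ⟩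
    obtain ⟨Φs, hΦs_top, ⟨hΦs, hlub⟩, hlim⟩ := hΦ.exists_memLp_top_isLUB
    exact ⟨Φ, hΦ.1, hTΦ, Φs, hΦs_top, ⟨hΦs, _, fun n => hlub.1 ⟨n, rfl⟩⟩, hlim⟩
  · rintro ⟨Φ, hΦ, hTΦ, Φs, -, ⟨hΦs, C, hC⟩, hlim⟩
    exact ⟨Φ, .of_tendsto hY hΦs hC hΦ hlim, hTΦ⟩
  · have hΦ_mem := hT.memKotheBochner hΦ hTΦ
    exact ⟨hΦ_mem, hΦ_mem.exists_memLp_top_isLUB⟩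

theorem mainTheorem1 {Ω : Type*} [MeasurableSpace Ω] (μ : MeasureTheory.Measure Ω)
    [MeasureTheory.IsFiniteMeasure μ] (X Y : BanachFunctionSpace μ) 
    (hXY : X.toSubmodule ≤ Y.toSubmodule)
    (hY : Y.HasFatouProperty) (T : X → Y) :
    (BanachFunctionSpace.StronglyLatticeLipschitz T ↔
      ∃ Φ : Ω → LipZero, AEStronglyMeasurable Φ μ ∧ BanachFunctionSpace.IsSuperposition T Φ ∧
        ∃ Φs : ℕ → Ω → LipZero,
          (∀ n, MemLp (Φs n) ∞ μ) ∧
          (∃ (h : ∀ n, BanachFunctionSpace.MemKotheBochner X Y (Φs n)) (C : ℝ),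
            ∀ n, BanachFunctionSpace.kotheBochnerNorm (h n) ≤ C) ∧
          ∀ᵐ w ∂μ, Tendsto (fun n => Φs n w) atTop (𝓝 (Φ w))) ∧
    (BanachFunctionSpace.StronglyLatticeLipschitz T →
      ∀ Φ : Ω → LipZero, AEStronglyMeasurable Φ μ → BanachFunctionSpace.IsSuperposition T Φ →
        ∃ (hΦ : BanachFunctionSpace.MemKotheBochner X Y Φ) (Φs : ℕ → Ω → LipZero),
          (∀ n, MemLp (Φs n) ∞ μ) ∧
          (∃ h : ∀ n, BanachFunctionSpace.MemKotheBochner X Y (Φs n),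
            IsLUB (range fun n => BanachFunctionSpace.kotheBochnerNorm (h n))
              (BanachFunctionSpace.kotheBochnerNorm hΦ)) ∧
          ∀ᵐ w ∂μ, Tendsto (fun n => Φs n w) atTop (𝓝 (Φ w))) :=
  mainTheorem1_general μ X Y hY T
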